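/- **Model and protocol.** There are $k\ge 1$ sites and a server. The protocol $\mathsf{Robust}$ with accuracy $\varepsilon>0$ and factor $c\ge 1$ works as follows. Site $i$ keeps an event counter $n_i$ (initially $0$) and a transmission probability $p$ (initially $1$). When an event arrives at site $i$, the site increments $n_i$, tosses a fresh independent coin with success probability $p$, and, on success, sends $\mathsf{ReportSample}$ to the server. The server keeps $p$ (initially $1$), a counter $B$ (initially $0$) and an exact count $\bar n$ (initially $0$), and publishes the estimate $\hat n=\bar n+B/p$. On each $\mathsf{ReportSample}$ it increments $B$; if then $B=k$, it sends $\mathsf{CountRequest}$ to all $k$ sites, every site replies with $n_i$, the server sets $\bar n\gets\sum_i n_i$, $p\gets\min\{1,\,c\sqrt{k}/(\varepsilon\bar n)\}$, $B\gets 0$, and sends $p$ to all $k$ sites, which adopt it. A broadcast counts as $k$ messages. A white-box adaptive event stream is generated by an adversary that chooses (possibly at random) the site of each event as a function of the complete history so far: all events, coin outcomes, messages and internal states. Let $\hat n(n)$ be the estimate after the $n$-th event has been processed, and $M_N$ the total number of messages sent during the first $N$ events, including those triggered by the $N$-th event. **Theorem.** There is an absolute constant $C>0$ such that for every $\delta\in(0,1)$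 there are constants $c=c(\delta)\ge 1$ and $C'=C'(\delta)>0$ for which the following holds for every $k\ge1$, every $\varepsilon>0$, and every white-box adaptive event stream, when $\mathsf{Robust}$ is run with the factor $c$. 1. (Per-event accuracy.) For every $n\ge 1$, $$\Pr\big[\,|\hat n(n)-n|>\varepsilon n\,\big]\le\delta .$$ 2. (Communication.) For every $N\ge 2$: if $\varepsilon\le 1$ or $N\ge 1+\sqrt{k}\,\varepsilon/c$, then $$\mathbb{E}[M_N]\le C\,\frac{k\log N}{\log\!\left(1+\frac{\sqrt{k}\,\varepsilon}{c}\right)} .$$ Moreover, for every $N\ge2$, $$\mathbb{E}[M_N]\le C'\,\frac{\sqrt{k}}{\varepsilon}\log N\quad\text{if }\varepsilon\le \frac{c}{\sqrt{k}},\qquad\qquad \mathbb{E}[M_N]\le C\,k\log N\quad\text{if }\varepsilon>\frac{c}{\sqrt{k}} .$$ -/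

import Mathlib

open scoped ENNReal

namespace DistributedCounting

/-- State of a site: its local copy of the transmission probability and its local event counter. -/
structure SiteState where
  prob : ℝ
  count : ℕ

/-- State of the server: the number `reports` of `ReportSample` messages received in the current
round (written `B` in the protocol), the exact site counts `base` collected at the beginning of the
current round, and the current transmission probability. -/
structure ServerState (k : ℕ) where
  reports : ℕ
  base : Fin k → ℕ
  prob : ℝ

/-- Global configuration of the system with `k` sites. -/
structure Config (k : ℕ) where
  sites : Fin k → SiteState
  server : ServerState k

/-- Messages between the server and site `i`. A broadcast consists of one message to each site. -/
inductive Message (k : ℕ) where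
  /-- `ReportSample()` sent by site `i` to the server -/
  | reportSample (i : Fin k)
  /-- `CountRequest()` sent by the server to site `i` -/
  | countRequest (i : Fin k)
  /-- `ReportCount(i, count)` sent by site `i` to the server -/
  | reportCount (i : Fin k) (count : ℕ)
  /-- `Broadcast(p)`, the copy sent by the server to site `i` -/
  | broadcast (i : Fin k) (p : ℝ)

/-- Initially all counters are `0` and all transmission probabilities are `1`. -/
def Config.init (k : ℕ) : Config k where
  sites := fun _ => { prob := 1, count := 0 }
  server := { reports := 0, base := fun _ => 0, prob := 1 }

/-- The running estimate `B / p + ∑ i, base i` published by the server. -/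
noncomputable def ServerState.estimate {k : ℕ} (s : ServerState k) : ℝ :=
  (s.reports : ℝ) / s.prob + ∑ i, (s.base i : ℝ)

/-- An event arrives at site `i`, which increments its local counter. -/
def Config.arrive {k : ℕ} (cfg : Config k) (i : Fin k) : Config k :=
  { cfg with
    sites := Function.update cfg.sites i
      { prob := (cfg.sites i).prob, count := (cfg.sites i).count + 1 } }

/-- The server counts a received `ReportSample` message. -/
def Config.countReport {k : ℕ} (cfg : Config k) : Config k :=
  { cfg with server := { cfg.server with reports := cfg.server.reports + 1 } }

/-- The total of the exact local counts of all sites. -/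
def Config.total {k : ℕ} (cfg : Config k) : ℕ := ∑ j, (cfg.sites j).count

/-- The transmission probability `min {1, c √k / (ε n̄)}` of a round that starts at the
exact count `nbar`. -/
noncomputable def roundProb (k : ℕ) (ε c : ℝ) (nbar : ℕ) : ℝ :=
  min 1 (c * √(k : ℝ) / (ε * nbar))

/-- Opening of a new round: the server broadcasts `CountRequest`, every site answers with
its count, the server computes the new probability, broadcasts it, and resets its counter of
reports. Returns the messages sent and the resulting configuration. -/
noncomputable def Config.openRound {k : ℕ} (ε c : ℝ) (cfg : Config k) :
    List (Message k) × Config k :=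
  let p := roundProb k ε c cfg.total
  (List.ofFn (fun j : Fin k => Message.countRequest j)
      ++ List.ofFn (fun j : Fin k => Message.reportCount j (cfg.sites j).count)
      ++ List.ofFn (fun j : Fin k => Message.broadcast j p),
    { sites := fun j => { prob := p, count := (cfg.sites j).count }
      server := { reports := 0, base := fun j => (cfg.sites j).count, prob := p } })

/-- Processing of an event at site `i` when the coin tossed by the site is `x`: the messages sent
and the resulting configuration. The round is closed when the `k`-th report is received. -/
noncomputable def Config.step {k : ℕ} (ε c : ℝ) (cfg : Config k) (i : Fin k) (x : Bool) :
    List (Message k) × Config k :=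
  if x then
    let cfg' := (cfg.arrive i).countReport
    if cfg'.server.reports = k then
      let r := cfg'.openRound ε c
      (Message.reportSample i :: r.1, r.2)
    else ([Message.reportSample i], cfg')
  else ([], cfg.arrive i)

/-- The full record of one event: the site it arrived at, the outcome of the coin of that site, all
messages sent because of it, and the state of the whole system after it. -/
structure Record (k : ℕ) where
  site : Fin k
  coin : Bool
  messages : List (Message k)
  after : Config k

/-- The history of an execution, with the most recent event first. -/
abbrev History (k : ℕ) := List (Record k)

/-- The current configuration after a given history. -/
def History.config {k : ℕ} : History k → Config k
  | [] => Config.init k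
  | r :: _ => r.after

/-- The total number of messages sent during a history. -/
def History.messageCount {k : ℕ} (h : History k) : ℕ :=
  (h.map fun r => r.messages.length).sum

/-- A white-box adaptive adversary: it chooses (possibly at random) the site of the next event as a
function of the complete history of events, coins, messages and internal states. Oblivious
event streams are the special case of constant choices. -/
abbrev Adversary (k : ℕ) := History k → PMF (Fin k)

/-- The Bernoulli law with parameter `p`. All the probabilities that occur in the protocol are in
`[0, 1]`; outside of this range `p` is truncated. -/
noncomputable def coinLaw (p : ℝ) : PMF Bool :=
  PMF.ofFintype
    (fun b => if b then min (ENNReal.ofReal p) 1 else 1 - min (ENNReal.ofReal p) 1)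
    (by simp [add_tsub_cancel_of_le])

/-- The law of the history of the first `n` events, when the protocol with parameters `k`, `ε`, `c`
is run against the adversary `adv`. For each event the adversary first chooses the site, and then
this site tosses a fresh coin with its local transmission probability. -/
noncomputable def execution (k : ℕ) (ε c : ℝ) (adv : Adversary k) : ℕ → PMF (History k)
  | 0 => PMF.pure []
  | n + 1 =>
    (execution k ε c adv n).bind fun h =>
      (adv h).bind fun i =>
        (coinLaw (h.config.sites i).prob).map fun x =>
          { site := i
            coin := x
            messages := (h.config.step ε c i x).1
            after := (h.config.step ε c i x).2 } :: h

/-- The probability that the estimate published after the `n`-th event is off by more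
than `ε n`. -/
noncomputable def failureProb (k : ℕ) (ε c : ℝ) (adv : Adversary k) (n : ℕ) : ℝ≥0∞ :=
  (execution k ε c adv n).toOuterMeasure
    {h | ε * n < |h.config.server.estimate - n|}

/-- The expected number of messages sent during the first `N` events. -/
noncomputable def expectedMessages (k : ℕ) (ε c : ℝ) (adv : Adversary k) (N : ℕ) : ℝ≥0∞ :=
  ∑' h, execution k ε c adv N h * (h.messageCount : ℝ≥0∞)

end DistributedCounting

/-!
At every time all sites use the transmission probability of the server, so the adversary has no
influence on the joint law of the number of events `n`, the exact count `n₀` at the opening of the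
current round, the number of reports `B` and the probability `p`. Both parts follow from potentials
of these quantities whose conditional expectation grows in a controlled way with every event,
whatever site is chosen (`expect_potential_le`).

*Accuracy.* Fix `n` and let `q` be the probability of a round that opens at exact count `n`; before
time `n` the probability in use is at least `q`. Look back over a window of `W ≈ c * k / q` events.
The expected waiting time for the next opening of a round is at most `k / q`, so by Markov's
inequality no round opens within the window with probability at most `1 / c`. Otherwise the error
was reset to `0` within the window, and since then its variance grew by at most `1 / q - 1` per event; resets
only decrease the squared error. Chebyshev's inequality gives `2 / c` for this case. The potential
`errorPotential` treats both cases at once, and `failureProb_le_three_div` is the conclusion.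

*Communication.* Put `x = √k * ε / c`. A round closes within `k / (2 * p)` events with probability at
most `1 / 2`, again by Markov's inequality. A longer round multiplies the exact count by at
least `1 + x / 2`, because `p * x * n₀ ≤ k`. So a round raises `log n₀ / log (1 + x / 2)` by `1` with
probability at least `1 / 2`, and the expected number of rounds up to time `N` is at
most `2 * (log N / log (1 + x / 2) + 1)`. Each round costs `4 * k` messages
(`messagePotential_step`, `expectedMessages_le`). The additive term is absorbed when `1 + x ≤ N`; for
`ε ≤ 1` and smaller `N` the deterministic bound of `4 * N` messages suffices.
-/

namespace DistributedCounting

variable {k : ℕ} {ε c : ℝ}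

/-! ### The state of the current round -/

/-- The number of reports that the server has received in the current round. -/
def History.reports (h : History k) : ℕ := h.config.server.reports

/-- The transmission probability of the current round. -/
def History.prob (h : History k) : ℝ := h.config.server.prob

/-- The number of events that had arrived when the current round was opened; it is `0` during the
initial round. -/
def History.roundStart (h : History k) : ℕ := ∑ i, h.config.server.base i

/-- The history after one more event, at site `i` and with coin outcome `x`. -/
noncomputable def History.extend (ε c : ℝ) (h : History k) (i : Fin k) (x : Bool) : History k :=
  { site := i
    coin := x
    messages := (h.config.step ε c i x).1
    after := (h.config.step ε c i x).2 } :: h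

lemma History.estimate_eq (h : History k) :
    h.config.server.estimate = h.reports / h.prob + h.roundStart := by
  simp [ServerState.estimate, History.reports, History.prob, History.roundStart]

lemma Config.total_arrive (cfg : Config k) (i : Fin k) :
    (cfg.arrive i).total = cfg.total + 1 := by
  have h : ∀ j, ((cfg.arrive i).sites j).count = (cfg.sites j).count + if j = i then 1 else 0 := by
    intro j
    by_cases hj : j = i
    · subst hj; simp [Config.arrive]
    · simp [Config.arrive, hj]
  simp [Config.total, h, Finset.sum_add_distrib]

lemma Config.arrive_prob (cfg : Config k) (i j : Fin k) :
    ((cfg.arrive i).sites j).prob = (cfg.sites j).prob := by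
  by_cases hj : j = i
  · subst hj; simp [Config.arrive]
  · simp [Config.arrive, hj]

lemma History.messageCount_extend (h : History k) (i : Fin k) (x : Bool) :
    (h.extend ε c i x).messageCount = (h.config.step ε c i x).1.length + h.messageCount := by
  simp [History.extend, History.messageCount]

/-- The facts about a history of `n` events that hold whatever the adversary and the coins did.
The last field bounds the communication by the number of events: a round with `k` reports costs
`4 * k` messages. -/
structure Consistent (ε c : ℝ) (n : ℕ) (h : History k) : Prop where
  site_prob : ∀ i, (h.config.sites i).prob = h.prob
  total_eq : h.config.total = n
  roundStart_add_le : h.roundStart + h.reports ≤ n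
  reports_lt : h.reports < k
  prob_eq : (h.roundStart = 0 ∧ h.prob = 1) ∨
    (0 < h.roundStart ∧ h.prob = roundProb k ε c h.roundStart)
  reports_le : h.reports ≤ h.messageCount
  messageCount_le : h.messageCount + 3 * h.reports ≤ 4 * n

lemma consistent_nil (hk : 1 ≤ k) : Consistent ε c 0 ([] : History k) where
  site_prob _ := rfl
  total_eq := by simp [History.config, Config.init, Config.total]
  roundStart_add_le := by simp [History.roundStart, History.reports, History.config, Config.init]
  reports_lt := hk
  prob_eq := by simp [History.roundStart, History.config, Config.init, History.prob]
  reports_le := by simp [History.reports, History.config, Config.init]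
  messageCount_le := by simp [History.reports, History.config, Config.init, History.messageCount]

lemma Consistent.roundStart_le {n : ℕ} {h : History k} (hc : Consistent ε c n h) :
    h.roundStart ≤ n :=
  (Nat.le_add_right _ _).trans hc.roundStart_add_le

section Extend

variable (ε c) (h : History k) (i : Fin k)

lemma config_extend_false : (h.extend ε c i false).config = h.config.arrive i := by
  change (h.config.step ε c i false).2 = _
  simp [Config.step]

lemma extend_false :
    (h.extend ε c i false).reports = h.reports ∧ (h.extend ε c i false).prob = h.prob ∧
      (h.extend ε c i false).roundStart = h.roundStart ∧
      (h.extend ε c i false).messageCount = h.messageCount := by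
  refine ⟨?_, ?_, ?_, ?_⟩
  · rw [History.reports, config_extend_false]; rfl
  · rw [History.prob, config_extend_false]; rfl
  · rw [History.roundStart, config_extend_false]; rfl
  · simp [History.messageCount_extend, Config.step]

variable {h}

lemma step_true_of_ne (hB : h.reports + 1 ≠ k) :
    h.config.step ε c i true = ([Message.reportSample i], (h.config.arrive i).countReport) :=
  if_neg (c := (h.config.arrive i).countReport.server.reports = k) hB

lemma config_extend_true_of_ne (hB : h.reports + 1 ≠ k) :
    (h.extend ε c i true).config = (h.config.arrive i).countReport :=
  congrArg Prod.snd (step_true_of_ne ε c i hB)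

lemma extend_true_of_ne (hB : h.reports + 1 ≠ k) :
    (h.extend ε c i true).reports = h.reports + 1 ∧ (h.extend ε c i true).prob = h.prob ∧
      (h.extend ε c i true).roundStart = h.roundStart ∧
      (h.extend ε c i true).messageCount = h.messageCount + 1 := by
  refine ⟨?_, ?_, ?_, ?_⟩
  · rw [History.reports, config_extend_true_of_ne ε c i hB]; rfl
  · rw [History.prob, config_extend_true_of_ne ε c i hB]; rfl
  · rw [History.roundStart, config_extend_true_of_ne ε c i hB]; rfl
  · rw [History.messageCount_extend, step_true_of_ne ε c i hB]; simp [add_comm]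

lemma step_true_of_eq (hB : h.reports + 1 = k) :
    h.config.step ε c i true =
      (Message.reportSample i :: ((h.config.arrive i).countReport.openRound ε c).1,
        ((h.config.arrive i).countReport.openRound ε c).2) :=
  if_pos (c := (h.config.arrive i).countReport.server.reports = k) hB

lemma config_extend_true_of_eq (hB : h.reports + 1 = k) :
    (h.extend ε c i true).config = ((h.config.arrive i).countReport.openRound ε c).2 := by
  change (h.config.step ε c i true).2 = _
  rw [step_true_of_eq ε c i hB]

lemma extend_true_of_eq {n : ℕ} (hc : Consistent ε c n h) (hB : h.reports + 1 = k) :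
    (h.extend ε c i true).reports = 0 ∧
      (h.extend ε c i true).prob = roundProb k ε c (n + 1) ∧
      (h.extend ε c i true).roundStart = n + 1 ∧
      (h.extend ε c i true).messageCount = h.messageCount + (3 * k + 1) := by
  have ht : (h.config.arrive i).countReport.total = n + 1 := by
    rw [← hc.total_eq, ← Config.total_arrive _ i]; rfl
  refine ⟨?_, ?_, ?_, ?_⟩
  · rw [History.reports, config_extend_true_of_eq ε c i hB]; rfl
  · rw [History.prob, config_extend_true_of_eq ε c i hB, ← ht]; rfl
  · rw [History.roundStart, config_extend_true_of_eq ε c i hB, ← ht]; rfl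
  · rw [History.messageCount_extend, step_true_of_eq ε c i hB]
    simp [Config.openRound]
    ring

variable {i}

lemma Consistent.extend {n : ℕ} (hc : Consistent ε c n h) (x : Bool) :
    Consistent ε c (n + 1) (h.extend ε c i x) := by
  have hlt := hc.reports_lt
  have hle := hc.reports_le
  have hm := hc.messageCount_le
  have hr := hc.roundStart_add_le
  have ht := Config.total_arrive h.config i
  rw [hc.total_eq] at ht
  cases x
  · obtain ⟨h1, h2, h3, h4⟩ := extend_false ε c h i
    refine ⟨fun j => ?_, ?_, by omega, by omega, by rw [h2, h3]; exact hc.prob_eq, by omega,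
      by omega⟩
    · rw [h2, ← hc.site_prob j, ← Config.arrive_prob h.config i, config_extend_false]
    · rw [config_extend_false, ht]
  · by_cases hB : h.reports + 1 = k
    · obtain ⟨h1, h2, h3, h4⟩ := extend_true_of_eq ε c i hc hB
      refine ⟨fun j => ?_, ?_, by omega, by omega, .inr ⟨by omega, by rw [h2, h3]⟩,
        by omega, by omega⟩
      · rw [History.prob, config_extend_true_of_eq ε c i hB]; rfl
      · rw [config_extend_true_of_eq ε c i hB, ← ht]; rfl
    · obtain ⟨h1, h2, h3, h4⟩ := extend_true_of_ne ε c i hB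
      refine ⟨fun j => ?_, ?_, by omega, by omega, by rw [h2, h3]; exact hc.prob_eq, by omega,
        by omega⟩
      · rw [h2, ← hc.site_prob j, ← Config.arrive_prob h.config i,
          config_extend_true_of_ne ε c i hB]; rfl
      · rw [config_extend_true_of_ne ε c i hB, ← ht]; rfl

end Extend

/-! ### Bounds on the transmission probability -/

lemma roundProb_pos (hk : 1 ≤ k) (hε : 0 < ε) (hc : 0 < c) {n : ℕ} (hn : 0 < n) :
    0 < roundProb k ε c n := by
  have : (0 : ℝ) < k := by exact_mod_cast hk
  have : (0 : ℝ) < n := by exact_mod_cast hn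
  exact lt_min one_pos (by positivity)

lemma roundProb_anti (hε : 0 < ε) (hc : 0 < c) {m n : ℕ} (hm : 0 < m) (hmn : m ≤ n) :
    roundProb k ε c n ≤ roundProb k ε c m := by
  have : (0 : ℝ) < m := by exact_mod_cast hm
  unfold roundProb
  gcongr

lemma Consistent.prob_le_one {n : ℕ} {h : History k} (hc : Consistent ε c n h) : h.prob ≤ 1 := by
  rcases hc.prob_eq with ⟨-, h1⟩ | ⟨-, h1⟩
  · exact h1.le
  · rw [h1]; exact min_le_left _ _

lemma Consistent.prob_pos {n : ℕ} {h : History k} (hh : Consistent ε c n h) (hk : 1 ≤ k)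
    (hε : 0 < ε) (hc : 0 < c) : 0 < h.prob := by
  rcases hh.prob_eq with ⟨-, h1⟩ | ⟨h0, h1⟩
  · rw [h1]; exact one_pos
  · rw [h1]; exact roundProb_pos hk hε hc h0

lemma Consistent.roundProb_le_prob {m n : ℕ} {h : History k} (hh : Consistent ε c m h)
    (hε : 0 < ε) (hc : 0 < c) (hmn : m ≤ n) : roundProb k ε c n ≤ h.prob := by
  rcases hh.prob_eq with ⟨-, h1⟩ | ⟨h0, h1⟩
  · rw [h1]; exact min_le_left _ _
  · rw [h1]; exact roundProb_anti hε hc h0 (hh.roundStart_le.trans hmn)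

/-! ### Expectations along the execution -/

lemma execution_succ (adv : Adversary k) (n : ℕ) :
    execution k ε c adv (n + 1) = (execution k ε c adv n).bind fun h =>
      (adv h).bind fun i => (coinLaw (h.config.sites i).prob).map fun x => h.extend ε c i x := rfl

lemma consistent_of_mem_support (hk : 1 ≤ k) (adv : Adversary k) (n : ℕ) :
    ∀ h, execution k ε c adv n h ≠ 0 → Consistent ε c n h := by
  induction n with
  | zero =>
    intro h hh
    have : h = [] := by
      by_contra h0
      exact hh (by simp [execution, h0])
    subst this
    exact consistent_nil hk
  | succ n ih =>
    intro h hh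
    rw [← PMF.mem_support_iff, execution_succ, PMF.mem_support_bind_iff] at hh
    obtain ⟨h', hh', hh⟩ := hh
    rw [PMF.mem_support_bind_iff] at hh
    obtain ⟨i, -, hh⟩ := hh
    rw [PMF.mem_support_map_iff] at hh
    obtain ⟨x, -, rfl⟩ := hh
    exact (ih h' hh').extend ε c x

/-- The expectation of `f` under the law `μ`. -/
noncomputable def expect {α : Type*} (μ : PMF α) (f : α → ℝ≥0∞) : ℝ≥0∞ := ∑' a, μ a * f a

lemma expect_bind {α β : Type*} (μ : PMF α) (κ : α → PMF β) (f : β → ℝ≥0∞) :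
    expect (μ.bind κ) f = expect μ fun a => expect (κ a) f := by
  simp only [expect, PMF.bind_apply, ← ENNReal.tsum_mul_right, ← ENNReal.tsum_mul_left]
  rw [ENNReal.tsum_comm]
  simp only [mul_assoc]

lemma expect_pure {α : Type*} (a : α) (f : α → ℝ≥0∞) : expect (PMF.pure a) f = f a := by
  rw [expect, tsum_eq_single a]
  · simp
  · intro b hb; simp [hb]

lemma expect_map {α β : Type*} (μ : PMF α) (g : α → β) (f : β → ℝ≥0∞) :
    expect (μ.map g) f = expect μ fun a => f (g a) := by
  rw [PMF.map, expect_bind]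
  simp [expect_pure]

lemma expect_const {α : Type*} (μ : PMF α) (r : ℝ≥0∞) : expect μ (fun _ => r) = r := by
  rw [expect, ENNReal.tsum_mul_right, μ.tsum_coe, one_mul]

lemma expect_mono {α : Type*} (μ : PMF α) {f g : α → ℝ≥0∞} (h : ∀ a, μ a ≠ 0 → f a ≤ g a) :
    expect μ f ≤ expect μ g := by
  refine ENNReal.tsum_le_tsum fun a => ?_
  by_cases ha : μ a = 0
  · simp [ha]
  · gcongr; exact h a ha

lemma expect_add {α : Type*} (μ : PMF α) (f g : α → ℝ≥0∞) :
    expect μ (fun a => f a + g a) = expect μ f + expect μ g := by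
  simp only [expect, mul_add, ENNReal.tsum_add]

lemma expect_coinLaw {p : ℝ} (hp0 : 0 ≤ p) (hp1 : p ≤ 1) {f : Bool → ℝ} (hf : ∀ x, 0 ≤ f x) :
    expect (coinLaw p) (fun x => ENNReal.ofReal (f x)) =
      ENNReal.ofReal (p * f true + (1 - p) * f false) := by
  have h1 : ENNReal.ofReal p ≤ 1 := by simpa using hp1
  rw [expect, tsum_bool, ENNReal.ofReal_add (mul_nonneg hp0 (hf _))
    (mul_nonneg (by linarith) (hf _)), ENNReal.ofReal_mul hp0, ENNReal.ofReal_mul (by linarith),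
    ENNReal.ofReal_sub _ hp0, add_comm]
  simp [coinLaw, min_eq_left h1]

/-- A potential that is nonnegative and whose conditional expectation grows by at most `v` with
each event, for every choice of the site, grows in expectation by at most `v` per event. -/
lemma expect_potential_le (hk : 1 ≤ k) (hε : 0 < ε) (hc : 0 < c) (adv : Adversary k)
    (f : ℕ → History k → ℝ) {v : ℝ} (hv : 0 ≤ v) (s : ℕ) {n : ℕ} (hsn : s ≤ n)
    (hf : ∀ m ≤ n, s ≤ m → ∀ h, Consistent ε c m h → 0 ≤ f m h)
    (hstep : ∀ m < n, s ≤ m → ∀ h, Consistent ε c m h → ∀ i,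
      h.prob * f (m + 1) (h.extend ε c i true) + (1 - h.prob) * f (m + 1) (h.extend ε c i false)
        ≤ f m h + v) :
    expect (execution k ε c adv n) (fun h => ENNReal.ofReal (f n h)) ≤
      expect (execution k ε c adv s) (fun h => ENNReal.ofReal (f s h)) +
        ENNReal.ofReal ((n - s : ℕ) * v) := by
  induction n, hsn using Nat.le_induction with
  | base => simp
  | succ n hsn ih =>
    have hle : expect (execution k ε c adv (n + 1)) (fun h => ENNReal.ofReal (f (n + 1) h)) ≤
        expect (execution k ε c adv n) (fun h => ENNReal.ofReal (f n h) + ENNReal.ofReal v) := by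
      rw [execution_succ, expect_bind]
      refine expect_mono _ fun h hh => ?_
      have hcon := consistent_of_mem_support hk adv n h hh
      rw [expect_bind, ← ENNReal.ofReal_add (hf n (by omega) hsn h hcon) hv]
      refine (expect_mono _ fun i _ => ?_).trans (expect_const (adv h) _).le
      rw [expect_map, hcon.site_prob i, expect_coinLaw (hcon.prob_pos hk hε hc).le
        hcon.prob_le_one
        (f := fun x => f (n + 1) (h.extend ε c i x))
        (fun x => hf (n + 1) le_rfl (by omega) _ (hcon.extend ε c x))]
      exact ENNReal.ofReal_le_ofReal (hstep n (by omega) hsn h hcon i)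
    rw [expect_add, expect_const] at hle
    refine hle.trans ?_
    have := ih (fun m hm => hf m (by omega)) (fun m hm => hstep m (by omega))
    refine (add_le_add_left this _).trans ?_
    rw [add_assoc, ← ENNReal.ofReal_add (by positivity) hv]
    refine add_le_add_right (ENNReal.ofReal_le_ofReal (le_of_eq ?_)) _
    rw [Nat.succ_sub hsn]
    push_cast
    ring

/-! ### Accuracy -/

/-- The difference between the published estimate and the number of events. -/
noncomputable def estimateError (n : ℕ) (h : History k) : ℝ := h.config.server.estimate - n

/-- The potential that controls the estimation error. While the current round is older than the
time `s`, it is a multiple of the number of missing reports, compensated by the drift `q`; from the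
first round opened after `s` on, it is a multiple of the squared error. -/
noncomputable def errorPotential (s : ℕ) (q a b : ℝ) (m : ℕ) (h : History k) : ℝ :=
  if h.roundStart < s then (k - h.reports + q * (m - s : ℝ)) * a
  else estimateError m h ^ 2 * b

lemma errorPotential_nonneg {s : ℕ} {q a b : ℝ} (hq : 0 ≤ q) (ha : 0 ≤ a) (hb : 0 ≤ b) {m : ℕ}
    (hm : s ≤ m) {h : History k} (hh : Consistent ε c m h) :
    0 ≤ errorPotential s q a b m h := by
  have h1 : (h.reports : ℝ) ≤ k := by exact_mod_cast hh.reports_lt.le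
  have h2 : (s : ℝ) ≤ m := by exact_mod_cast hm
  unfold errorPotential
  split_ifs
  · exact mul_nonneg (add_nonneg (by linarith) (mul_nonneg hq (by linarith))) ha
  · positivity

lemma errorPotential_step (hk : 1 ≤ k) (hε : 0 < ε) (hc : 0 < c) {s : ℕ} {q a b : ℝ} (hq : 0 < q)
    (ha : 0 ≤ a) (hb : 0 ≤ b) {m : ℕ} (hm : s ≤ m) {h : History k} (hh : Consistent ε c m h)
    (hqp : q ≤ h.prob) (i : Fin k) :
    h.prob * errorPotential s q a b (m + 1) (h.extend ε c i true) +
      (1 - h.prob) * errorPotential s q a b (m + 1) (h.extend ε c i false) ≤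
      errorPotential s q a b m h + b * (1 / q - 1) := by
  have hp0 := hh.prob_pos hk hε hc
  have hp1 := hh.prob_le_one
  have hms : (s : ℝ) ≤ m := by exact_mod_cast hm
  have hinv : 1 / h.prob ≤ 1 / q := one_div_le_one_div_of_le hq hqp
  have hinv1 : 1 ≤ 1 / h.prob := one_le_one_div hp0 hp1
  have hv : 0 ≤ b * (1 / q - 1) := mul_nonneg hb (by linarith)
  obtain ⟨f1, f2, f3, -⟩ := extend_false ε c h i
  -- The error vanishes at the opening of a round, so the potential of a closed round is at most
  -- the value it would take if the report were merely counted.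
  by_cases hs : h.roundStart < s
  · have hF : errorPotential s q a b (m + 1) (h.extend ε c i false) =
        (k - h.reports + q * (m + 1 - s)) * a := by
      rw [errorPotential, f1, f3, if_pos hs]; push_cast; rfl
    have hT : errorPotential s q a b (m + 1) (h.extend ε c i true) ≤
        (k - (h.reports + 1) + q * (m + 1 - s)) * a := by
      by_cases hB : h.reports + 1 = k
      · obtain ⟨t1, t2, t3, -⟩ := extend_true_of_eq ε c i hh hB
        have hk' : (k : ℝ) = h.reports + 1 := by exact_mod_cast hB.symm
        rw [errorPotential, t3, if_neg (by omega), estimateError, History.estimate_eq, t1, t3, hk']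
        have : 0 ≤ q * (m + 1 - s) * a :=
          mul_nonneg (mul_nonneg hq.le (by linarith)) ha
        simpa using this
      · obtain ⟨t1, t2, t3, -⟩ := extend_true_of_ne ε c i hB
        rw [errorPotential, t1, t3, if_pos hs]; push_cast; rfl
    have hP : errorPotential s q a b m h = (k - h.reports + q * (m - s)) * a := by
      rw [errorPotential, if_pos hs]
    have := mul_le_mul_of_nonneg_left hT hp0.le
    rw [hF, hP]
    have := mul_nonneg (sub_nonneg.2 hqp) ha
    linarith
  · set Y := estimateError m h with hY
    have hF : errorPotential s q a b (m + 1) (h.extend ε c i false) = (Y - 1) ^ 2 * b := by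
      rw [errorPotential, f3, if_neg hs, hY, estimateError, estimateError, History.estimate_eq,
        History.estimate_eq, f1, f2, f3]
      push_cast; ring
    have hT : errorPotential s q a b (m + 1) (h.extend ε c i true) ≤
        (Y + 1 / h.prob - 1) ^ 2 * b := by
      by_cases hB : h.reports + 1 = k
      · obtain ⟨t1, t2, t3, -⟩ := extend_true_of_eq ε c i hh hB
        rw [errorPotential, t3, if_neg (by omega), estimateError, History.estimate_eq, t1, t3]
        have : 0 ≤ (Y + 1 / h.prob - 1) ^ 2 * b := by positivity
        simpa using this
      · obtain ⟨t1, t2, t3, -⟩ := extend_true_of_ne ε c i hB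
        rw [errorPotential, t3, if_neg hs, hY, estimateError, estimateError, History.estimate_eq,
          History.estimate_eq, t1, t2, t3]
        push_cast
        exact le_of_eq (by ring)
    have hP : errorPotential s q a b m h = Y ^ 2 * b := by
      rw [errorPotential, if_neg hs]
    have hvar : h.prob * ((Y + 1 / h.prob - 1) ^ 2 * b) + (1 - h.prob) * ((Y - 1) ^ 2 * b) =
        Y ^ 2 * b + b * (1 / h.prob - 1) := by
      field_simp; ring
    have := mul_le_mul_of_nonneg_left hT hp0.le
    have := mul_le_mul_of_nonneg_left hinv hb
    rw [hF, hP]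
    linarith

lemma errorPotential_self_le {s : ℕ} {q a b : ℝ} (ha : 0 ≤ a) {h : History k}
    (hh : Consistent ε c s h) : errorPotential s q a b s h ≤ k * a := by
  unfold errorPotential
  split_ifs with hs
  · gcongr
    have : (0 : ℝ) ≤ h.reports := by positivity
    linarith
  · have h1 := hh.roundStart_add_le
    have hB : h.reports = 0 := by omega
    have hn : h.roundStart = s := by omega
    rw [estimateError, History.estimate_eq, hB, hn]
    have : 0 ≤ (k : ℝ) * a := by positivity
    simpa using this

/-- The bound on the failure probability with a free lookback window of `W` events: the first term
bounds the probability that no round is opened within the window, the second one the probability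
that the error accumulated since the first opening within the window is too large. -/
lemma failureProb_le (hk : 1 ≤ k) (hε : 0 < ε) (hc : 0 < c) (adv : Adversary k) {n : ℕ}
    (hn : 1 ≤ n) {W : ℕ} (hW : 0 < W) :
    failureProb k ε c adv n ≤ ENNReal.ofReal (k / (roundProb k ε c n * W) +
      W * ((1 / roundProb k ε c n - 1) / (ε * n) ^ 2)) := by
  set q := roundProb k ε c n with hqdef
  have hq : 0 < q := roundProb_pos hk hε hc hn
  have hq1 : 1 ≤ 1 / q := one_le_one_div hq (min_le_left _ _)
  have hn' : (0 : ℝ) < n := by exact_mod_cast hn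
  have hW' : (0 : ℝ) < W := by exact_mod_cast hW
  set a : ℝ := 1 / (q * W) with ha_def
  set b : ℝ := 1 / (ε * n) ^ 2 with hb_def
  have ha : 0 ≤ a := by positivity
  have hb : 0 ≤ b := by positivity
  have hv : 0 ≤ b * (1 / q - 1) := mul_nonneg hb (by linarith)
  have hsn : n - W ≤ n := Nat.sub_le _ _
  have key := expect_potential_le hk hε hc adv (errorPotential (n - W) q a b) hv (n - W) hsn
    (fun m _ hm h hh => errorPotential_nonneg hq.le ha hb hm hh)
    (fun m hm hs h hh i => errorPotential_step hk hε hc hq ha hb hs hh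
      (hh.roundProb_le_prob hε hc hm.le) i)
  have hfail : failureProb k ε c adv n ≤ expect (execution k ε c adv n)
      (fun h => ENNReal.ofReal (errorPotential (n - W) q a b n h)) := by
    rw [failureProb, PMF.toOuterMeasure_apply, expect]
    refine ENNReal.tsum_le_tsum fun h => ?_
    by_cases h0 : execution k ε c adv n h = 0
    · simp [Set.indicator_apply, h0]
    have hh := consistent_of_mem_support hk adv n h h0
    rw [Set.indicator_apply]
    split_ifs with hbad
    · refine le_mul_of_one_le_right (zero_le) ?_
      rw [ENNReal.one_le_ofReal, errorPotential]
      split_ifs with hs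
      · have hWn : ((n - W : ℕ) : ℝ) = n - W := Nat.cast_sub (by omega)
        have hB : (h.reports : ℝ) ≤ k := by exact_mod_cast hh.reports_lt.le
        rw [hWn, ha_def, mul_one_div, one_le_div (by positivity)]
        linarith
      · rw [hb_def, mul_one_div, one_le_div (by positivity), ← sq_abs (estimateError n h)]
        have : ε * n < |estimateError n h| := hbad
        gcongr
    · exact zero_le
  have hstart : expect (execution k ε c adv (n - W))
      (fun h => ENNReal.ofReal (errorPotential (n - W) q a b (n - W) h)) ≤
      ENNReal.ofReal (k * a) := by
    refine (expect_mono _ fun h hh => ENNReal.ofReal_le_ofReal ?_).trans (expect_const _ _).le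
    exact errorPotential_self_le ha (consistent_of_mem_support hk adv _ h hh)
  refine (hfail.trans key).trans ((add_le_add_left hstart _).trans ?_)
  rw [← ENNReal.ofReal_add (by positivity) (by positivity)]
  apply ENNReal.ofReal_le_ofReal
  have hlen : ((n - (n - W) : ℕ) : ℝ) ≤ W := by exact_mod_cast (by omega : n - (n - W) ≤ W)
  have := mul_le_mul_of_nonneg_right hlen hv
  have e1 : (k : ℝ) * a = k / (q * W) := by rw [ha_def, mul_one_div]
  have e2 : b * (1 / q - 1) = (1 / q - 1) / (ε * n) ^ 2 := by rw [hb_def]; ring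
  rw [e1]
  rw [e2] at this ⊢
  linarith

lemma failureProb_le_three_div (hk : 1 ≤ k) (hε : 0 < ε) (hc : 1 ≤ c) (adv : Adversary k) {n : ℕ}
    (hn : 1 ≤ n) : failureProb k ε c adv n ≤ ENNReal.ofReal (3 / c) := by
  have hc0 : 0 < c := by linarith
  have hn' : (0 : ℝ) < n := by exact_mod_cast hn
  have hk' : (1 : ℝ) ≤ k := by exact_mod_cast hk
  set q := roundProb k ε c n with hqdef
  have hq : 0 < q := roundProb_pos hk hε hc0 hn
  have hq1 : q ≤ 1 := min_le_left _ _
  -- A window of this length contains `c * k` reports in expectation.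
  have hx : 1 ≤ c * k / q := by
    rw [one_le_div hq]; nlinarith
  have hWle := (Nat.ceil_lt_add_one (by positivity : 0 ≤ c * k / q)).le
  have hWge := Nat.le_ceil (c * k / q)
  have hW : 0 < ⌈c * k / q⌉₊ := Nat.ceil_pos.2 (by positivity)
  refine (failureProb_le hk hε hc0 adv hn hW).trans (ENNReal.ofReal_le_ofReal ?_)
  rw [← hqdef]
  set W : ℝ := (⌈c * k / q⌉₊ : ℝ)
  have hW0 : 0 < W := by linarith
  have h1 : k / (q * W) ≤ 1 / c := by
    rw [div_le_div_iff₀ (by positivity) hc0, one_mul]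
    rw [div_le_iff₀ hq] at hWge
    linarith
  have h2 : W * ((1 / q - 1) / (ε * n) ^ 2) ≤ 2 / c := by
    rcases hq1.eq_or_lt with h | h
    · rw [h]; simp; positivity
    · have hqe : q = c * √(k : ℝ) / (ε * n) := by
        have h' := hqdef
        unfold roundProb at h'
        rcases min_choice 1 (c * √(k : ℝ) / (ε * n)) with h'' | h'' <;> rw [h''] at h'
        · exact absurd h' h.ne
        · exact h'
      have hsq : √(k : ℝ) ^ 2 = k := Real.sq_sqrt (by positivity)
      have hqn : (q * (ε * n)) ^ 2 = c ^ 2 * k := by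
        rw [hqe, div_mul_cancel₀ _ (by positivity), mul_pow, hsq]
      calc W * ((1 / q - 1) / (ε * n) ^ 2)
          ≤ (2 * (c * k / q)) * ((1 / q) / (ε * n) ^ 2) := by
            gcongr
            · exact div_nonneg (by linarith [one_le_one_div hq hq1]) (by positivity)
            · linarith
            · linarith
        _ = 2 * c * k / (q * (ε * n)) ^ 2 := by field_simp
        _ = 2 / c := by rw [hqn]; field_simp
  calc _ ≤ 1 / c + 2 / c := add_le_add h1 h2
    _ = 3 / c := by ring

/-! ### Communication -/

/-- An upper bound for the conditional probability that a round with transmission probability `p`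
closes within its first `k / (2 * p)` events, given that `B` reports were received among its first
`t` events. It is Markov's inequality for the number of reports among these `k / (2 * p)` events. -/
noncomputable def earlyCloseBound (k : ℕ) (p B t : ℝ) : ℝ :=
  if p * t ≤ k / 2 then (B + k / 2 - p * t) / k else 0

lemma earlyCloseBound_nonneg {p B t : ℝ} (hB : 0 ≤ B) : 0 ≤ earlyCloseBound k p B t := by
  unfold earlyCloseBound
  split_ifs with h
  · exact div_nonneg (by linarith) (by positivity)
  · exact le_rfl

lemma earlyCloseBound_step {p B t : ℝ} (hp : 0 ≤ p) (hB : 0 ≤ B) :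
    p * earlyCloseBound k p (B + 1) (t + 1) + (1 - p) * earlyCloseBound k p B (t + 1) ≤
      earlyCloseBound k p B t := by
  by_cases h : p * (t + 1) ≤ k / 2
  · have h' : p * t ≤ k / 2 := by linarith
    unfold earlyCloseBound
    rw [if_pos h, if_pos h, if_pos h']
    exact le_of_eq (by ring)
  · have := earlyCloseBound_nonneg (k := k) (p := p) (t := t) hB
    rw [earlyCloseBound, earlyCloseBound, if_neg h, if_neg h]
    linarith

/-- The progress of an execution: the logarithm of the exact count at the opening of the round, in
units of `l`, plus a lower bound for the conditional probability that the current round is not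
closed early. The initial round, whose exact count is `0`, makes no progress. -/
noncomputable def progress (l : ℝ) (m : ℕ) (h : History k) : ℝ :=
  if h.roundStart = 0 then 0
  else Real.log h.roundStart / l + 1 - earlyCloseBound k h.prob h.reports (m - h.roundStart)

/-- The potential that controls the communication. The difference of the numbers of messages sent
and of reports in the current round is `4 * k` times the number of closed rounds. Each round makes
a progress of at least `1 / 2` in expectation, and `Λ` bounds the total progress. -/
noncomputable def messagePotential (l Λ : ℝ) (m : ℕ) (h : History k) : ℝ :=
  h.messageCount - h.reports + 8 * k * (Λ - progress l m h)

lemma progress_le {l : ℝ} (hl : 0 < l) {m N : ℕ} (hmN : m ≤ N) {h : History k}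
    (hh : Consistent ε c m h) : progress l m h ≤ Real.log N / l + 1 := by
  unfold progress
  split_ifs with h0
  · have := Real.log_natCast_nonneg N
    positivity
  · have h1 : (0 : ℝ) < h.roundStart := by exact_mod_cast Nat.pos_of_ne_zero h0
    have h2 : (h.roundStart : ℝ) ≤ N := by exact_mod_cast hh.roundStart_le.trans hmN
    have h3 := earlyCloseBound_nonneg (k := k) (p := h.prob) (t := m - h.roundStart)
      (by positivity : (0 : ℝ) ≤ h.reports)
    have : Real.log h.roundStart / l ≤ Real.log N / l := by gcongr
    linarith

lemma Consistent.prob_mul_roundStart_le {m : ℕ} {h : History k} (hh : Consistent ε c m h)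
    (hε : 0 < ε) (hc : 0 < c) : h.prob * (√(k : ℝ) * ε / c * h.roundStart) ≤ k := by
  rcases hh.prob_eq with ⟨h0, -⟩ | ⟨h0, h1⟩
  · simp [h0]
  · have h0' : (0 : ℝ) < h.roundStart := by exact_mod_cast h0
    have hsq : √(k : ℝ) * √(k : ℝ) = k := Real.mul_self_sqrt (by positivity)
    calc h.prob * (√(k : ℝ) * ε / c * h.roundStart)
        ≤ c * √(k : ℝ) / (ε * h.roundStart) * (√(k : ℝ) * ε / c * h.roundStart) := by
          gcongr
          rw [h1]; exact min_le_right _ _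
      _ = √(k : ℝ) * √(k : ℝ) := by field_simp
      _ = k := hsq

/-- Here `x` stands for `√k * ε / c`. At the closing of a round, either the round was long and the
exact count has grown by the factor `1 + x / 2`, or the round was short and `earlyCloseBound` has
reached `1`. -/
lemma one_le_log_add_earlyCloseBound (hk : 1 ≤ k) {x p n₀ n : ℝ} (hx : 0 < x) (hp : 0 < p)
    (hn₀ : 0 < n₀) (hn : n₀ ≤ n) (hpx : p * (x * n₀) ≤ k) :
    1 + Real.log n₀ / Real.log (1 + x / 2) ≤
      Real.log n / Real.log (1 + x / 2) + earlyCloseBound k p k (n - n₀) := by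
  have hk' : (0 : ℝ) < k := by exact_mod_cast hk
  have hl : 0 < Real.log (1 + x / 2) := Real.log_pos (by linarith)
  unfold earlyCloseBound
  split_ifs with h
  · have h1 : Real.log n₀ / Real.log (1 + x / 2) ≤ Real.log n / Real.log (1 + x / 2) := by gcongr
    have h2 : 1 ≤ (k + k / 2 - p * (n - n₀)) / k := by
      rw [one_le_div hk']; linarith
    linarith
  · have h1 : (1 + x / 2) * n₀ ≤ n := by
      by_contra hlt
      have : p * (n - n₀) ≤ p * (x * n₀ / 2) := by
        gcongr; linarith
      exact h (by linarith)
    have h2 : Real.log (1 + x / 2) + Real.log n₀ ≤ Real.log n := by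
      rw [← Real.log_mul (by positivity) hn₀.ne']
      exact Real.log_le_log (by positivity) h1
    have h3 : (Real.log (1 + x / 2) + Real.log n₀) / Real.log (1 + x / 2) ≤
        Real.log n / Real.log (1 + x / 2) := by gcongr
    rw [add_div, div_self hl.ne'] at h3
    linarith

lemma messagePotential_step (hk : 1 ≤ k) (hε : 0 < ε) (hc : 0 < c) (Λ : ℝ) {m : ℕ}
    {h : History k} (hh : Consistent ε c m h) (i : Fin k) :
    h.prob * messagePotential (Real.log (1 + √(k : ℝ) * ε / c / 2)) Λ (m + 1)
        (h.extend ε c i true) +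
      (1 - h.prob) * messagePotential (Real.log (1 + √(k : ℝ) * ε / c / 2)) Λ (m + 1)
        (h.extend ε c i false) ≤
      messagePotential (Real.log (1 + √(k : ℝ) * ε / c / 2)) Λ m h := by
  have hk' : (0 : ℝ) < k := by exact_mod_cast hk
  set x := √(k : ℝ) * ε / c with hxdef
  have hx : 0 < x := by positivity
  set l := Real.log (1 + x / 2)
  have hl : 0 < l := Real.log_pos (by linarith)
  have hp0 := hh.prob_pos hk hε hc
  obtain ⟨f1, f2, f3, f4⟩ := extend_false ε c h i
  -- The potential after a closing of the round: the new round starts with `earlyCloseBound` equal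
  -- to `1 / 2`.
  have hclose : h.reports + 1 = k →
      messagePotential l Λ (m + 1) (h.extend ε c i true) =
        h.messageCount - h.reports + 8 * k * (Λ - Real.log (m + 1) / l) := by
    intro hB
    obtain ⟨t1, t2, t3, t4⟩ := extend_true_of_eq ε c i hh hB
    have hk'' : (h.reports : ℝ) = k - 1 := by
      have : (k : ℝ) = h.reports + 1 := by exact_mod_cast hB.symm
      linarith
    have hhalf : earlyCloseBound k (roundProb k ε c (m + 1)) 0 0 = 1 / 2 := by
      unfold earlyCloseBound
      rw [if_pos (by rw [mul_zero]; positivity)]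
      field_simp
      ring
    rw [messagePotential, progress, t1, t2, t3, t4, if_neg (Nat.succ_ne_zero m), sub_self,
      Nat.cast_zero, hhalf, hk'']
    push_cast
    ring
  by_cases h0 : h.roundStart = 0
  · have hF : messagePotential l Λ (m + 1) (h.extend ε c i false) =
        messagePotential l Λ m h := by
      rw [messagePotential, messagePotential, progress, progress, f1, f3, f4, if_pos h0, if_pos h0]
    have hT : messagePotential l Λ (m + 1) (h.extend ε c i true) ≤ messagePotential l Λ m h := by
      by_cases hB : h.reports + 1 = k
      · rw [hclose hB, messagePotential, progress, if_pos h0]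
        have : 0 ≤ Real.log (m + 1) / l :=
          div_nonneg (Real.log_nonneg (by linarith [(Nat.cast_nonneg m : (0 : ℝ) ≤ m)])) hl.le
        gcongr
      · obtain ⟨t1, t2, t3, t4⟩ := extend_true_of_ne ε c i hB
        rw [messagePotential, messagePotential, progress, progress, t1, t3, t4, if_pos h0,
          if_pos h0]
        push_cast
        exact le_of_eq (by ring)
    rw [hF]
    have := mul_le_mul_of_nonneg_left hT hp0.le
    linarith
  · have hn0 : (0 : ℝ) < h.roundStart := by exact_mod_cast Nat.pos_of_ne_zero h0
    have hnm : (h.roundStart : ℝ) ≤ m := by exact_mod_cast hh.roundStart_le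
    set base : ℝ := h.messageCount - h.reports + 8 * k * (Λ - Real.log h.roundStart / l - 1)
      with hbase
    have hP : messagePotential l Λ m h =
        base + 8 * k * earlyCloseBound k h.prob h.reports (m - h.roundStart) := by
      rw [messagePotential, progress, if_neg h0]; ring
    have hF : messagePotential l Λ (m + 1) (h.extend ε c i false) =
        base + 8 * k * earlyCloseBound k h.prob h.reports (m - h.roundStart + 1) := by
      rw [messagePotential, progress, f1, f2, f3, f4, if_neg h0]
      push_cast
      rw [add_sub_right_comm (m : ℝ)]
      ring
    have hT : messagePotential l Λ (m + 1) (h.extend ε c i true) ≤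
        base + 8 * k * earlyCloseBound k h.prob (h.reports + 1) (m - h.roundStart + 1) := by
      by_cases hB : h.reports + 1 = k
      · have hk'' : (h.reports : ℝ) + 1 = k := by exact_mod_cast hB
        have := one_le_log_add_earlyCloseBound hk hx hp0 hn0
          (hnm.trans (le_add_of_nonneg_right zero_le_one))
          (hh.prob_mul_roundStart_le hε hc)
        have := mul_le_mul_of_nonneg_left this (by positivity : 0 ≤ 8 * (k : ℝ))
        rw [hclose hB, hk'', hbase, ← add_sub_right_comm (m : ℝ)]
        linarith
      · obtain ⟨t1, t2, t3, t4⟩ := extend_true_of_ne ε c i hB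
        rw [messagePotential, progress, t1, t2, t3, t4, if_neg h0]
        push_cast
        rw [add_sub_right_comm (m : ℝ)]
        exact le_of_eq (by ring)
    have hg := earlyCloseBound_step (k := k) (t := m - h.roundStart) hp0.le
      (by positivity : (0 : ℝ) ≤ h.reports)
    have := mul_le_mul_of_nonneg_left hg (by positivity : 0 ≤ 8 * (k : ℝ))
    have := mul_le_mul_of_nonneg_left hT hp0.le
    rw [hF, hP]
    linarith

lemma expectedMessages_eq (adv : Adversary k) (N : ℕ) :
    expectedMessages k ε c adv N =
      expect (execution k ε c adv N) (fun h => (h.messageCount : ℝ≥0∞)) := rfl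

lemma expectedMessages_le_four_mul (hk : 1 ≤ k) (adv : Adversary k) (N : ℕ) :
    expectedMessages k ε c adv N ≤ ENNReal.ofReal (4 * N) := by
  rw [expectedMessages_eq]
  refine (expect_mono _ fun h hh => ?_).trans (expect_const _ _).le
  have := (consistent_of_mem_support hk adv N h hh).messageCount_le
  rw [← ENNReal.ofReal_natCast]
  apply ENNReal.ofReal_le_ofReal
  exact_mod_cast (by omega : h.messageCount ≤ 4 * N)

lemma log_one_add_le_two_mul {x : ℝ} (hx : 0 ≤ x) :
    Real.log (1 + x) ≤ 2 * Real.log (1 + x / 2) := by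
  rw [← Nat.cast_two, ← Real.log_pow]
  apply Real.log_le_log (by linarith)
  push_cast
  nlinarith [sq_nonneg x]

lemma expectedMessages_le (hk : 1 ≤ k) (hε : 0 < ε) (hc : 0 < c) (adv : Adversary k) (N : ℕ) :
    expectedMessages k ε c adv N ≤
      ENNReal.ofReal (16 * (k * Real.log N / Real.log (1 + √(k : ℝ) * ε / c)) + 9 * k) := by
  have hk' : (0 : ℝ) < k := by exact_mod_cast hk
  set x := √(k : ℝ) * ε / c with hxdef
  have hx : 0 < x := by positivity
  set l := Real.log (1 + x / 2) with hldef
  have hl : 0 < l := Real.log_pos (by linarith)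
  set Λ := Real.log N / l + 1 with hΛ
  have hN := Real.log_natCast_nonneg N
  have hnonneg : ∀ m ≤ N, ∀ h : History k, Consistent ε c m h →
      (h.messageCount : ℝ) - h.reports ≤ messagePotential l Λ m h := by
    intro m hm h hh
    have := mul_nonneg (by positivity : 0 ≤ 8 * (k : ℝ)) (sub_nonneg.2 (progress_le hl hm hh))
    rw [messagePotential]
    linarith
  have key := expect_potential_le hk hε hc adv (messagePotential l Λ) le_rfl 0 (Nat.zero_le N)
    (fun m hm _ h hh => by
      have h1 := hnonneg m hm h hh
      have h2 : (h.reports : ℝ) ≤ h.messageCount := by exact_mod_cast hh.reports_le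
      linarith)
    (fun m _ _ h hh i => by
      rw [add_zero]; exact messagePotential_step hk hε hc Λ hh i)
  have h0 : expect (execution k ε c adv 0)
      (fun h => ENNReal.ofReal (messagePotential l Λ 0 h)) = ENNReal.ofReal (8 * k * Λ) := by
    rw [execution, expect_pure]
    simp [messagePotential, progress, History.messageCount, History.reports, History.roundStart,
      History.config, Config.init]
  rw [h0, mul_zero, ENNReal.ofReal_zero, add_zero] at key
  have hfin : expectedMessages k ε c adv N ≤ expect (execution k ε c adv N)
      (fun h => ENNReal.ofReal (messagePotential l Λ N h) + ENNReal.ofReal k) := by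
    rw [expectedMessages_eq]
    refine expect_mono _ fun h hh => ?_
    have hh := consistent_of_mem_support hk adv N h hh
    have h1 := hnonneg N le_rfl h hh
    have h2 : (h.reports : ℝ) ≤ h.messageCount := by exact_mod_cast hh.reports_le
    have h3 : (h.reports : ℝ) ≤ k := by exact_mod_cast hh.reports_lt.le
    rw [← ENNReal.ofReal_add (by linarith) hk'.le, ← ENNReal.ofReal_natCast]
    exact ENNReal.ofReal_le_ofReal (by linarith)
  rw [expect_add, expect_const] at hfin
  refine hfin.trans ((add_le_add_left key _).trans ?_)
  rw [← ENNReal.ofReal_add (by positivity) hk'.le]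
  apply ENNReal.ofReal_le_ofReal
  have hL : 0 < Real.log (1 + x) := Real.log_pos (by linarith)
  have h1 : Real.log N / l ≤ 2 * (Real.log N / Real.log (1 + x)) := by
    rw [← mul_div_assoc, div_le_div_iff₀ hl hL]
    have := mul_le_mul_of_nonneg_left (log_one_add_le_two_mul hx.le) hN
    linarith
  have h2 := mul_le_mul_of_nonneg_left h1 (by positivity : 0 ≤ 8 * (k : ℝ))
  rw [hΛ, mul_div_assoc]
  linarith

lemma log_two_le_log_natCast {N : ℕ} (hN : 2 ≤ N) : Real.log 2 ≤ Real.log N :=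
  Real.log_le_log two_pos (by exact_mod_cast hN)

lemma expectedMessages_le_of_log_le (hk : 1 ≤ k) (hε : 0 < ε) (hc : 0 < c) (adv : Adversary k)
    {N : ℕ} (hN : Real.log (1 + √(k : ℝ) * ε / c) ≤ Real.log N) :
    expectedMessages k ε c adv N ≤
      ENNReal.ofReal (25 * (k * Real.log N / Real.log (1 + √(k : ℝ) * ε / c))) := by
  have hk' : (0 : ℝ) < k := by exact_mod_cast hk
  have hx : 0 < √(k : ℝ) * ε / c := by positivity
  have hL : 0 < Real.log (1 + √(k : ℝ) * ε / c) := Real.log_pos (by linarith)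
  refine (expectedMessages_le hk hε hc adv N).trans (ENNReal.ofReal_le_ofReal ?_)
  have : (k : ℝ) ≤ k * Real.log N / Real.log (1 + √(k : ℝ) * ε / c) := by
    rw [le_div_iff₀ hL]; gcongr
  linarith

/-- For `ε ≤ 1` the general bound holds also when no round has been closed: then the stream is so
short that the number of events itself is small enough. -/
lemma expectedMessages_le_of_le_one (hk : 1 ≤ k) (hε : 0 < ε) (hε1 : ε ≤ 1) (hc : 1 ≤ c)
    (adv : Adversary k) {N : ℕ} (hN : 2 ≤ N) (hNx : (N : ℝ) < 1 + √(k : ℝ) * ε / c) :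
    expectedMessages k ε c adv N ≤
      ENNReal.ofReal (25 * (k * Real.log N / Real.log (1 + √(k : ℝ) * ε / c))) := by
  have hk' : (1 : ℝ) ≤ k := by exact_mod_cast hk
  have hs : 1 ≤ √(k : ℝ) := Real.one_le_sqrt.2 hk'
  have hsq : √(k : ℝ) * √(k : ℝ) = k := Real.mul_self_sqrt (by positivity)
  have hx : 0 < √(k : ℝ) * ε / c := by positivity
  have hxs : √(k : ℝ) * ε / c ≤ √(k : ℝ) := by
    rw [div_le_iff₀ (by linarith)]
    gcongr
    linarith
  have hL : 0 < Real.log (1 + √(k : ℝ) * ε / c) := Real.log_pos (by linarith)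
  have hLs : Real.log (1 + √(k : ℝ) * ε / c) ≤ √(k : ℝ) := by
    have := Real.log_le_sub_one_of_pos (by linarith : 0 < 1 + √(k : ℝ) * ε / c)
    linarith
  refine (expectedMessages_le_four_mul hk adv N).trans (ENNReal.ofReal_le_ofReal ?_)
  have hlog : 1 / 2 ≤ Real.log N := by
    linarith [log_two_le_log_natCast hN, Real.log_two_gt_d9]
  have h1 : √(k : ℝ) * (1 / 2) ≤ k * Real.log N / Real.log (1 + √(k : ℝ) * ε / c) := by
    rw [le_div_iff₀ hL]
    calc √(k : ℝ) * (1 / 2) * Real.log (1 + √(k : ℝ) * ε / c)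
        ≤ √(k : ℝ) * Real.log N * √(k : ℝ) := by gcongr
      _ = k * Real.log N := by rw [mul_right_comm, hsq]
  linarith

/-- For `ε ≤ c / √k` the logarithm in the general bound is proportional to `√k * ε / c`. -/
lemma div_log_one_add_le (hk : 1 ≤ k) (hε : 0 < ε) (hc : 0 < c) (hx1 : √(k : ℝ) * ε / c ≤ 1)
    {L : ℝ} (hL : 0 ≤ L) :
    k * L / Real.log (1 + √(k : ℝ) * ε / c) ≤ 2 * c * (√(k : ℝ) / ε * L) := by
  have hk' : (0 : ℝ) < k := by exact_mod_cast hk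
  have hs : 0 < √(k : ℝ) := Real.sqrt_pos.2 hk'
  have hsq : √(k : ℝ) * √(k : ℝ) = k := Real.mul_self_sqrt hk'.le
  set x := √(k : ℝ) * ε / c with hxdef
  have hx : 0 < x := by positivity
  have hlog : x / 2 ≤ Real.log (1 + x) := by
    have h1 := Real.one_sub_inv_le_log_of_pos (by linarith : 0 < 1 + x)
    have h2 : x / 2 ≤ 1 - (1 + x)⁻¹ := by
      have : 1 - (1 + x)⁻¹ = x / (1 + x) := by field_simp; ring
      rw [this]
      gcongr
      linarith
    linarith
  calc k * L / Real.log (1 + x) ≤ k * L / (x / 2) := by gcongr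
    _ = √(k : ℝ) * √(k : ℝ) * L / (x / 2) := by rw [hsq]
    _ = 2 * c * (√(k : ℝ) / ε * L) := by rw [hxdef]; field_simp

end DistributedCounting

theorem theorem3p1 :
    ∃ C : ℝ, 0 < C ∧ ∀ δ : ℝ, 0 < δ → δ < 1 →
      ∃ c : ℝ, 1 ≤ c ∧ ∃ C' : ℝ, 0 < C' ∧
        ∀ (k : ℕ) (ε : ℝ) (adv : DistributedCounting.Adversary k), 1 ≤ k → 0 < ε →
          (∀ n : ℕ, 1 ≤ n →
            DistributedCounting.failureProb k ε c adv n ≤ ENNReal.ofReal δ) ∧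
          (∀ N : ℕ, 2 ≤ N →
            ((ε ≤ 1 ∨ 1 + √(k : ℝ) * ε / c ≤ (N : ℝ)) →
              DistributedCounting.expectedMessages k ε c adv N ≤
                ENNReal.ofReal
                  (C * ((k : ℝ) * Real.log N / Real.log (1 + √(k : ℝ) * ε / c)))) ∧
            (ε ≤ c / √(k : ℝ) →
              DistributedCounting.expectedMessages k ε c adv N ≤
                ENNReal.ofReal (C' * (√(k : ℝ) / ε * Real.log N))) ∧
            (c / √(k : ℝ) < ε →
              DistributedCounting.expectedMessages k ε c adv N ≤
                ENNReal.ofReal (C * ((k : ℝ) * Real.log N)))) := by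
  refine ⟨50, by norm_num, fun δ hδ hδ1 => ⟨3 / δ, ?_, 50 * (3 / δ), by positivity, ?_⟩⟩
  · rw [one_le_div hδ]; linarith
  intro k ε adv hk hε
  have hc1 : 1 ≤ 3 / δ := by rw [one_le_div hδ]; linarith
  have h3 : 3 / (3 / δ) = δ := by field_simp
  refine ⟨fun n hn =>
    (DistributedCounting.failureProb_le_three_div hk hε hc1 adv hn).trans_eq (by rw [h3]), ?_⟩
  generalize 3 / δ = c at hc1
  intro N hN
  have hc : 0 < c := by linarith
  have hk' : (0 : ℝ) < k := by exact_mod_cast hk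
  have hs : 0 < √(k : ℝ) := Real.sqrt_pos.2 hk'
  have hN' : (2 : ℝ) ≤ N := by exact_mod_cast hN
  have hlog2 := DistributedCounting.log_two_le_log_natCast hN
  have hlog2' := Real.log_two_gt_d9
  have hx : 0 < √(k : ℝ) * ε / c := by positivity
  have hL : 0 < Real.log (1 + √(k : ℝ) * ε / c) := Real.log_pos (by linarith)
  have hlarge : 1 + √(k : ℝ) * ε / c ≤ (N : ℝ) → DistributedCounting.expectedMessages k ε c adv N ≤
      ENNReal.ofReal (25 * (k * Real.log N / Real.log (1 + √(k : ℝ) * ε / c))) := fun h =>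
    DistributedCounting.expectedMessages_le_of_log_le hk hε hc adv
      (Real.log_le_log (by linarith) h)
  refine ⟨fun h => ?_, fun h => ?_, fun h => ?_⟩
  · have h25 : DistributedCounting.expectedMessages k ε c adv N ≤
        ENNReal.ofReal (25 * (k * Real.log N / Real.log (1 + √(k : ℝ) * ε / c))) := by
      by_cases hNx : 1 + √(k : ℝ) * ε / c ≤ (N : ℝ)
      · exact hlarge hNx
      · exact DistributedCounting.expectedMessages_le_of_le_one hk hε (h.resolve_right hNx) hc1 adv
          hN (not_le.1 hNx)
    refine h25.trans (ENNReal.ofReal_le_ofReal ?_)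
    have : 0 ≤ k * Real.log N / Real.log (1 + √(k : ℝ) * ε / c) :=
      div_nonneg (mul_nonneg hk'.le (by linarith)) hL.le
    linarith
  · have hx1 : √(k : ℝ) * ε / c ≤ 1 := by
      rw [le_div_iff₀ hs] at h
      rw [div_le_one hc]
      linarith
    refine (hlarge (by linarith)).trans (ENNReal.ofReal_le_ofReal ?_)
    have := DistributedCounting.div_log_one_add_le hk hε hc hx1 (by linarith : 0 ≤ Real.log N)
    linarith
  · refine (DistributedCounting.expectedMessages_le hk hε hc adv N).trans
      (ENNReal.ofReal_le_ofReal ?_)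
    have hx1 : 1 ≤ √(k : ℝ) * ε / c := by
      rw [div_lt_iff₀ hs] at h
      rw [one_le_div hc]
      linarith
    have hhalf : 1 / 2 ≤ Real.log (1 + √(k : ℝ) * ε / c) := by
      have := Real.log_le_log two_pos (by linarith : 2 ≤ 1 + √(k : ℝ) * ε / c)
      linarith
    have h1 : k * Real.log N / Real.log (1 + √(k : ℝ) * ε / c) ≤ k * Real.log N / (1 / 2) := by
      have : 0 ≤ Real.log N := by linarith
      gcongr
    have h2 : (k : ℝ) * (1 / 2) ≤ k * Real.log N := by gcongr; linarith
    linarith
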